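/- Let $X,U,Y$ be random variables on a probability space $(\Omega,\mathcal F,P)$ with values in measurable spaces $\mathcal X,\mathcal U,\mathcal Y$ carrying $\sigma$-finite reference measures $dx,du,dy$ (for instance Lebesgue measure on Euclidean spaces). Assume that $X$, $U$, $(X,U)$ and $(X,Y)$ have densities $f(x)$, $f(u)$, $f(x,u)$, $f(x,y)$ (fixed nonnegative measurable versions), and write $f(u|x)=f(x,u)/f(x)$, $f(x|u)=f(x,u)/f(u)$, $f(y|x)=f(x,y)/f(x)$, with value $0$ where a denominator vanishes. Let $L^2(f(u))$ and $L^2(f(x))$ be the spaces of measurable functions that are square-integrable with respect to $f(u)\,du$ and $f(x)\,dx$, and define $$K:L^2(f(u))\to L^2(f(x)),\quad (Kh)(x)=\int h(u)f(u|x)\,du,\qquad (K^*g)(u)=\int g(x)f(x|u)\,dx .$$ Let $(\lambda_n,\phi_n,\psi_n)_n$ be a singular value decomposition of $K$, indexed by a countable (possibly finite) set: $\lambda_n>0$, $(\phi_n)$ and $(\psi_n)$ are orthonormal in $L^2(f(u))$ and $L^2(f(x))$ respectively, $K\phi_n=\lambda_n\psi_n$, $K^*\psi_n=\lambda_n\phi_n$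 almost everywhere, and $Kh=0$ for every $h\in L^2(f(u))$ orthogonal to all $\phi_n$. **Theorem.** Suppose that 1. the conditional law $\mathcal L_{X|U}$ is complete for square-integrable functions: for every $g\in L^2(f(x))$, $E[g(X)|U]=\int g(x)f(x|U)\,dx=0$ almost surely if and only if $g(X)=0$ almost surely; 2. $\iint f(u|x)f(x|u)\,dx\,du<\infty$; 3. $\int f(y|x)^2f(x)\,dx<\infty$ for every $y\in\mathcal Y$; 4. $\sum_n\lambda_n^{-2}\,|\langle f(y|\cdot),\psi_n\rangle|<\infty$ for every $y\in\mathcal Y$, where $\langle f(y|\cdot),\psi_n\rangle=\int f(y|x)\psi_n(x)f(x)\,dx$. Then there exists a jointly measurable function $h:\mathcal U\times\mathcal Y\to\mathbb R$, with $h(\cdot,y)\in L^2(f(u))$ for every $y$, such that for every $y\in\mathcal Y$ and for almost every $x$ (with respect to the law of $X$) the integral $\int h(u,y)f(u|x)\,du$ converges absolutely and $$\int h(u,y)\,f(u|x)\,du=f(y|x).$$ -/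

import Mathlib

open MeasureTheory

/-- `f` is a (real-valued version of a) probability density of the random element `Z` with respect
to the reference measure `μ`. -/
def IsDensity {Ω E : Type*} [MeasurableSpace Ω] [MeasurableSpace E]
    (P : Measure Ω) (Z : Ω → E) (μ : Measure E) (f : E → ℝ) : Prop :=
  Measurable f ∧ (∀ z, 0 ≤ f z) ∧ P.map Z = μ.withDensity (fun z => ENNReal.ofReal (f z))

/-- The conditional density `f(b | a) = f(a, b) / f(a)` obtained from a joint density `f` on
`A × B` and the marginal density `fA` on `A`. -/
noncomputable def condSnd {A B : Type*} (f : A × B → ℝ) (fA : A → ℝ) (b : B) (a : A) : ℝ :=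
  f (a, b) / fA a

/-- The conditional density `f(a | b) = f(a, b) / f(b)` obtained from a joint density `f` on
`A × B` and the marginal density `fB` on `B`. -/
noncomputable def condFst {A B : Type*} (f : A × B → ℝ) (fB : B → ℝ) (a : A) (b : B) : ℝ :=
  f (a, b) / fB b

/-- `g` belongs to `L²(f)`, the measurable functions with `∫ g² f dμ < ∞`. -/
def MemL2Density {E : Type*} [MeasurableSpace E] (μ : Measure E) (f : E → ℝ) (g : E → ℝ) : Prop :=
  Measurable g ∧ Integrable (fun z => g z ^ 2 * f z) μ

/-- The inner product `⟨g₁, g₂⟩ = ∫ g₁ g₂ f dμ` of `L²(f)`. -/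
noncomputable def innerDensity {E : Type*} [MeasurableSpace E] (μ : Measure E) (f : E → ℝ)
    (g₁ g₂ : E → ℝ) : ℝ :=
  ∫ z, g₁ z * g₂ z * f z ∂μ

section

variable {𝒳 𝒰 : Type*} [MeasurableSpace 𝒳] [MeasurableSpace 𝒰]

/-- The operator `K : L²(f(u)) → L²(f(x))`, `(K h)(x) = ∫ h(u) f(u|x) du = E[h(U) | X = x]`. -/
noncomputable def condOp (μU : Measure 𝒰) (fXU : 𝒳 × 𝒰 → ℝ) (fX : 𝒳 → ℝ)
    (h : 𝒰 → ℝ) (x : 𝒳) : ℝ :=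
  ∫ u, h u * condSnd fXU fX u x ∂μU

/-- The adjoint `K* : L²(f(x)) → L²(f(u))`, `(K* g)(u) = ∫ g(x) f(x|u) dx = E[g(X) | U = u]`. -/
noncomputable def condOpAdj (μX : Measure 𝒳) (fXU : 𝒳 × 𝒰 → ℝ) (fU : 𝒰 → ℝ)
    (g : 𝒳 → ℝ) (u : 𝒰) : ℝ :=
  ∫ x, g x * condFst fXU fU x u ∂μX

/-- Completeness of the conditional law of `X` given `U` for square-integrable functions: for every
`g ∈ L²(f(x))`, `E[g(X) | U] = 0` almost surely if and only if `g(X) = 0` almost surely. -/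
def CompleteFstGivenSnd (μX : Measure 𝒳) (lawX : Measure 𝒳) (lawU : Measure 𝒰)
    (fXU : 𝒳 × 𝒰 → ℝ) (fX : 𝒳 → ℝ) (fU : 𝒰 → ℝ) : Prop :=
  ∀ g : 𝒳 → ℝ, MemL2Density μX fX g →
    ((∀ᵐ u ∂lawU, condOpAdj μX fXU fU g u = 0) ↔ ∀ᵐ x ∂lawX, g x = 0)

/-- `(s n, φ n, ψ n)` is a singular value decomposition (singular system) of
`K : L²(f(u)) → L²(f(x))`: `s n > 0`, the `φ n` and the `ψ n` are orthonormal in `L²(f(u))` and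
`L²(f(x))`, `K φ n = s n ψ n`, `K* ψ n = s n φ n`, and `K` vanishes on the orthogonal complement
of the `φ n`. The index type is countable, finite when `K` has finite rank. -/
structure IsSingularSystem {ι : Type*} (μX : Measure 𝒳) (μU : Measure 𝒰)
    (lawX : Measure 𝒳) (lawU : Measure 𝒰)
    (fXU : 𝒳 × 𝒰 → ℝ) (fX : 𝒳 → ℝ) (fU : 𝒰 → ℝ)
    (s : ι → ℝ) (φ : ι → 𝒰 → ℝ) (ψ : ι → 𝒳 → ℝ) : Prop where
  pos : ∀ n, 0 < s n
  memL2_left : ∀ n, MemL2Density μU fU (φ n)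
  memL2_right : ∀ n, MemL2Density μX fX (ψ n)
  norm_left : ∀ n, innerDensity μU fU (φ n) (φ n) = 1
  norm_right : ∀ n, innerDensity μX fX (ψ n) (ψ n) = 1
  orthogonal_left : ∀ m n, m ≠ n → innerDensity μU fU (φ m) (φ n) = 0
  orthogonal_right : ∀ m n, m ≠ n → innerDensity μX fX (ψ m) (ψ n) = 0
  map_left : ∀ n, ∀ᵐ x ∂lawX, condOp μU fXU fX (φ n) x = s n * ψ n x
  map_right : ∀ n, ∀ᵐ u ∂lawU, condOpAdj μX fXU fU (ψ n) u = s n * φ n u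
  kernel : ∀ h : 𝒰 → ℝ, MemL2Density μU fU h → (∀ n, innerDensity μU fU h (φ n) = 0) →
    ∀ᵐ x ∂lawX, condOp μU fXU fX h x = 0

end

open ProbabilityTheory

/-! The solution is Picard's series `h(u, y) = ∑ₙ λₙ⁻¹ cₙ(y) φₙ(u)` with `cₙ(y) = ⟨f(y|·), ψₙ⟩`.
Since `λₙ ≤ 1`, its coefficients are absolutely summable, and ℓ¹ coefficients against unit vectors
make the pointwise series square-integrable (`memLp_two_tsum_mul`). So `h` can be defined pointwise,
which yields joint measurability, instead of as an L² limit for each `y`. Adjointness gives `⟨K h,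
ψₙ⟩ = ⟨h, K* ψₙ⟩ = λₙ ⟨h, φₙ⟩ = cₙ`, so the residual `f(y|·) - K h` is orthogonal to every `ψₙ`.
Completeness makes `K*` injective, hence the `ψₙ` total, and the residual vanishes almost
everywhere. -/

/-! ### Passing between densities and laws. -/

theorem IsDensity.swap {Ω A B : Type*} [MeasurableSpace Ω] [MeasurableSpace A] [MeasurableSpace B]
    {P : Measure Ω} {X : Ω → A} {U : Ω → B} (hX : Measurable X) (hU : Measurable U)
    {μ : Measure A} {ν : Measure B} [SigmaFinite μ] [SigmaFinite ν] {f : A × B → ℝ}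
    (hf : IsDensity P (fun ω => (X ω, U ω)) (μ.prod ν) f) :
    IsDensity P (fun ω => (U ω, X ω)) (ν.prod μ) (fun z => f z.swap) := by
  obtain ⟨hm, h0, hmap⟩ := hf
  refine ⟨hm.comp measurable_swap, fun z => h0 _, ?_⟩
  have h1 : P.map (fun ω => (U ω, X ω)) = (P.map (fun ω => (X ω, U ω))).map Prod.swap := by
    rw [Measure.map_map measurable_swap (hX.prodMk hU)]
    rfl
  rw [h1, hmap]
  ext t ht
  rw [Measure.map_apply measurable_swap ht, withDensity_apply _ (measurable_swap ht),
    withDensity_apply _ ht, ← Measure.prod_swap (μ := ν) (ν := μ),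
    setLIntegral_map (measurable_swap ht) hm.ennreal_ofReal measurable_swap]
  rfl

theorem IsDensity.integral_map {Ω E : Type*} [MeasurableSpace Ω] [MeasurableSpace E]
    {P : Measure Ω} {Z : Ω → E} {μ : Measure E} {f : E → ℝ} (hf : IsDensity P Z μ f)
    (g : E → ℝ) : ∫ z, g z ∂(P.map Z) = ∫ z, g z * f z ∂μ := by
  rw [hf.2.2, integral_withDensity_eq_integral_toReal_smul hf.1.ennreal_ofReal (by simp)]
  refine integral_congr_ae (.of_forall fun z => ?_)
  simp [ENNReal.toReal_ofReal (hf.2.1 z), mul_comm]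

theorem IsDensity.integrable_map {Ω E : Type*} [MeasurableSpace Ω] [MeasurableSpace E]
    {P : Measure Ω} {Z : Ω → E} {μ : Measure E} {f : E → ℝ} (hf : IsDensity P Z μ f)
    (g : E → ℝ) : Integrable g (P.map Z) ↔ Integrable (fun z => g z * f z) μ := by
  rw [hf.2.2, integrable_withDensity_iff hf.1.ennreal_ofReal (by simp)]
  simp [ENNReal.toReal_ofReal (hf.2.1 _)]

theorem IsDensity.memL2Density_iff {Ω E : Type*} [MeasurableSpace Ω] [MeasurableSpace E]
    {P : Measure Ω} {Z : Ω → E} {μ : Measure E} {f : E → ℝ} (hf : IsDensity P Z μ f)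
    (g : E → ℝ) : MemL2Density μ f g ↔ Measurable g ∧ MemLp g 2 (P.map Z) := by
  refine and_congr_right fun hg => ?_
  rw [memLp_two_iff_integrable_sq hg.aestronglyMeasurable, hf.integrable_map]

theorem IsDensity.innerDensity_eq {Ω E : Type*} [MeasurableSpace Ω] [MeasurableSpace E]
    {P : Measure Ω} {Z : Ω → E} {μ : Measure E} {f : E → ℝ} (hf : IsDensity P Z μ f)
    (g₁ g₂ : E → ℝ) : innerDensity μ f g₁ g₂ = ∫ z, g₁ z * g₂ z ∂(P.map Z) :=
  (hf.integral_map _).symm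

/-! ### Conditional densities as a disintegration; conditional expectation on L². -/

section CondKernel

variable {Ω A B : Type*} [MeasurableSpace Ω] [MeasurableSpace A] [MeasurableSpace B]

theorem measurable_condSnd {f : A × B → ℝ} {fA : A → ℝ} (hf : Measurable f) (hfA : Measurable fA) :
    Measurable (fun z : A × B => condSnd f fA z.2 z.1) :=
  hf.div (hfA.comp measurable_fst)

theorem measurable_condSnd_left {f : A × B → ℝ} {fA : A → ℝ} (hf : Measurable f)
    (hfA : Measurable fA) (a : A) : Measurable (fun b => condSnd f fA b a) :=
  (measurable_condSnd hf hfA).comp measurable_prodMk_left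

theorem condSnd_nonneg {A B : Type*} {f : A × B → ℝ} {fA : A → ℝ} (hf : ∀ z, 0 ≤ f z) (hfA : ∀ a, 0 ≤ fA a)
    (b : B) (a : A) : 0 ≤ condSnd f fA b a :=
  div_nonneg (hf _) (hfA _)

/-- The kernel with density `f(b | a)` with respect to `ν`. -/
noncomputable def condDensityKernel (ν : Measure B) [SFinite ν] (f : A × B → ℝ) (fA : A → ℝ) :
    Kernel A B :=
  (Kernel.const A ν).withDensity fun a b => ENNReal.ofReal (condSnd f fA b a)

instance (ν : Measure B) [SFinite ν] (f : A × B → ℝ) (fA : A → ℝ) :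
    IsSFiniteKernel (condDensityKernel ν f fA) :=
  by
  rw [condDensityKernel]
  exact Kernel.IsSFiniteKernel.withDensity _ (fun _ _ => ENNReal.ofReal_ne_top)

theorem condDensityKernel_apply (ν : Measure B) [SFinite ν] {f : A × B → ℝ} {fA : A → ℝ}
    (hf : Measurable f) (hfA : Measurable fA) (a : A) :
    condDensityKernel ν f fA a = ν.withDensity fun b => ENNReal.ofReal (condSnd f fA b a) := by
  rw [condDensityKernel, Kernel.withDensity_apply _ (measurable_condSnd hf hfA).ennreal_ofReal,
    Kernel.const_apply]

variable {P : Measure Ω} {X : Ω → A} {U : Ω → B}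
  {μ : Measure A} {ν : Measure B} [SigmaFinite μ] [SigmaFinite ν] {f : A × B → ℝ} {fA : A → ℝ}

/-- Both sides are densities of the law of `X`, and densities with respect to a σ-finite measure are
unique almost everywhere. -/
theorem IsDensity.lintegral_snd_ae_eq (hX : Measurable X) (hU : Measurable U)
    (hfA : IsDensity P X μ fA) (hf : IsDensity P (fun ω => (X ω, U ω)) (μ.prod ν) f) :
    ∀ᵐ a ∂μ, ∫⁻ b, ENNReal.ofReal (f (a, b)) ∂ν = ENNReal.ofReal (fA a) := by
  have hm : Measurable fun a => ∫⁻ b, ENNReal.ofReal (f (a, b)) ∂ν :=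
    hf.1.ennreal_ofReal.lintegral_prod_right'
  refine (withDensity_eq_iff_of_sigmaFinite hm.aemeasurable hfA.1.ennreal_ofReal.aemeasurable).1 ?_
  rw [← hfA.2.2]
  ext t ht
  have h1 : P.map X t = P.map (fun ω => (X ω, U ω)) (t ×ˢ Set.univ) := by
    rw [Measure.map_apply hX ht, Measure.map_apply (hX.prodMk hU) (ht.prod .univ)]
    congr 1
    ext ω
    simp
  rw [h1, hf.2.2, withDensity_apply _ ht, withDensity_apply _ (ht.prod .univ),
    ← Measure.prod_restrict, Measure.restrict_univ,
    lintegral_prod _ hf.1.ennreal_ofReal.aemeasurable]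

/-- Where `fA` vanishes, division by zero makes the kernel the zero measure; the law of `X` does not
charge this set. -/
theorem IsDensity.isProbabilityMeasure_condDensityKernel (hX : Measurable X) (hU : Measurable U)
    (hfA : IsDensity P X μ fA) (hf : IsDensity P (fun ω => (X ω, U ω)) (μ.prod ν) f) :
    ∀ᵐ a ∂(P.map X), IsProbabilityMeasure (condDensityKernel ν f fA a) := by
  rw [hfA.2.2, ae_withDensity_iff hfA.1.ennreal_ofReal]
  filter_upwards [hfA.lintegral_snd_ae_eq hX hU hf] with a ha h0
  refine ⟨?_⟩
  have hpos : 0 < fA a := by simpa using h0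
  rw [condDensityKernel_apply ν hf.1 hfA.1, withDensity_apply _ .univ, Measure.restrict_univ]
  simp_rw [condSnd, ENNReal.ofReal_div_of_pos hpos, div_eq_mul_inv]
  rw [lintegral_mul_const', ha, ENNReal.mul_inv_cancel h0 (by simp)]
  simpa using hpos

variable [IsProbabilityMeasure P]

theorem IsDensity.compProd_condDensityKernel (hX : Measurable X) (hU : Measurable U)
    (hfA : IsDensity P X μ fA) (hf : IsDensity P (fun ω => (X ω, U ω)) (μ.prod ν) f) :
    P.map X ⊗ₘ condDensityKernel ν f fA = P.map (fun ω => (X ω, U ω)) := by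
  have : IsProbabilityMeasure (P.map X) := Measure.isProbabilityMeasure_map hX.aemeasurable
  ext t ht
  rw [Measure.compProd_apply ht, hf.2.2, withDensity_apply _ ht, ← lintegral_indicator ht,
    lintegral_prod _ (hf.1.ennreal_ofReal.indicator ht).aemeasurable, hfA.2.2,
    lintegral_withDensity_eq_lintegral_mul _ hfA.1.ennreal_ofReal
      (Kernel.measurable_kernel_prodMk_left ht)]
  refine lintegral_congr_ae ?_
  filter_upwards [hfA.lintegral_snd_ae_eq hX hU hf] with a ha
  have hta : MeasurableSet (Prod.mk a ⁻¹' t) := measurable_prodMk_left ht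
  have hma : Measurable fun b => ENNReal.ofReal (f (a, b)) :=
    hf.1.ennreal_ofReal.comp measurable_prodMk_left
  have hR : ∫⁻ b, t.indicator (fun z => ENNReal.ofReal (f z)) (a, b) ∂ν
      = ∫⁻ b in Prod.mk a ⁻¹' t, ENNReal.ofReal (f (a, b)) ∂ν := by
    rw [← lintegral_indicator hta]
    rfl
  rw [hR, Pi.mul_apply, condDensityKernel_apply ν hf.1 hfA.1, withDensity_apply _ hta]
  rcases (hfA.2.1 a).eq_or_lt with h0 | h0
  -- If `fA a = 0`, the section `f (a, ·)` has integral zero, so both sides vanish.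
  · rw [← h0] at ha ⊢
    rw [ENNReal.ofReal_zero, zero_mul]
    exact (le_antisymm ((setLIntegral_le_lintegral _ _).trans (by simp [ha])) zero_le).symm
  · rw [← lintegral_const_mul']
    · refine lintegral_congr fun b => ?_
      rw [← ENNReal.ofReal_mul h0.le, condSnd, mul_div_cancel₀ _ h0.ne']
    · simp

theorem integral_condDensityKernel {f : A × B → ℝ} {fA : A → ℝ}
    (hf : Measurable f) (hf0 : ∀ z, 0 ≤ f z) (hfA : Measurable fA) (hfA0 : ∀ a, 0 ≤ fA a)
    (h : B → ℝ) (a : A) :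
    ∫ b, h b ∂(condDensityKernel ν f fA a) = condOp ν f fA h a := by
  rw [condDensityKernel_apply ν hf hfA, integral_withDensity_eq_integral_toReal_smul
    (measurable_condSnd_left hf hfA a).ennreal_ofReal (by simp)]
  refine integral_congr_ae (.of_forall fun z => ?_)
  simp [ENNReal.toReal_ofReal (condSnd_nonneg hf0 hfA0 z a), mul_comm]

theorem integrable_condDensityKernel {f : A × B → ℝ} {fA : A → ℝ}
    (hf : Measurable f) (hf0 : ∀ z, 0 ≤ f z) (hfA : Measurable fA) (hfA0 : ∀ a, 0 ≤ fA a)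
    (h : B → ℝ) (a : A) :
    Integrable h (condDensityKernel ν f fA a) ↔
      Integrable (fun b => h b * condSnd f fA b a) ν := by
  rw [condDensityKernel_apply ν hf hfA, integrable_withDensity_iff
    (measurable_condSnd_left hf hfA a).ennreal_ofReal (by simp)]
  simp [ENNReal.toReal_ofReal (condSnd_nonneg hf0 hfA0 _ a)]

theorem measurable_condOp {f : A × B → ℝ} {fA : A → ℝ}
    (hf : Measurable f) (hfA : Measurable fA) {h : B → ℝ} (hh : Measurable h) :
    Measurable (condOp ν f fA h) := by
  have : StronglyMeasurable (fun z : A × B => h z.2 * condSnd f fA z.2 z.1) :=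
    ((hh.comp measurable_snd).mul (measurable_condSnd hf hfA)).stronglyMeasurable
  exact this.integral_prod_right'.measurable

/-- `∫ (K h) g d(law X) = E[g(X) h(U)]`. -/
theorem IsDensity.integral_condOp_mul (hX : Measurable X) (hU : Measurable U)
    (hfA : IsDensity P X μ fA) (hf : IsDensity P (fun ω => (X ω, U ω)) (μ.prod ν) f)
    {h : B → ℝ} {g : A → ℝ} (hh : Measurable h) (hg : Measurable g)
    (hint : Integrable (fun ω => h (U ω) * g (X ω)) P) :
    ∫ a, condOp ν f fA h a * g a ∂(P.map X) = ∫ ω, h (U ω) * g (X ω) ∂P := by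
  have : IsProbabilityMeasure (P.map X) := Measure.isProbabilityMeasure_map hX.aemeasurable
  have hm : Measurable fun z : A × B => h z.2 * g z.1 := by fun_prop
  have hXU : Measurable fun ω => (X ω, U ω) := hX.prodMk hU
  have e : ∫ ω, h (U ω) * g (X ω) ∂P
      = ∫ z, h z.2 * g z.1 ∂(P.map X ⊗ₘ condDensityKernel ν f fA) := by
    rw [hfA.compProd_condDensityKernel hX hU hf,
      MeasureTheory.integral_map hXU.aemeasurable hm.aestronglyMeasurable]
  rw [e, Measure.integral_compProd]
  · refine integral_congr_ae (.of_forall fun a => ?_)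
    simp only [← integral_condDensityKernel hf.1 hf.2.1 hfA.1 hfA.2.1, integral_mul_const]
  · rw [hfA.compProd_condDensityKernel hX hU hf,
      integrable_map_measure hm.aestronglyMeasurable hXU.aemeasurable]
    exact hint

theorem IsDensity.ae_integrable_condDensityKernel (hX : Measurable X) (hU : Measurable U)
    (hfA : IsDensity P X μ fA) (hf : IsDensity P (fun ω => (X ω, U ω)) (μ.prod ν) f)
    {h : B → ℝ} (hint : Integrable h (P.map U)) :
    (∀ᵐ a ∂(P.map X), Integrable h (condDensityKernel ν f fA a)) ∧
      Integrable (condOp ν f fA h) (P.map X) := by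
  have : IsProbabilityMeasure (P.map X) := Measure.isProbabilityMeasure_map hX.aemeasurable
  have hXU : Measurable fun ω => (X ω, U ω) := hX.prodMk hU
  have hi : Integrable (fun z : A × B => h z.2) (P.map X ⊗ₘ condDensityKernel ν f fA) := by
    rw [hfA.compProd_condDensityKernel hX hU hf]
    have e : P.map U = (P.map (fun ω => (X ω, U ω))).map Prod.snd := by
      rw [Measure.map_map measurable_snd hXU]
      rfl
    rw [e] at hint
    exact hint.comp_measurable measurable_snd
  refine ⟨((Measure.integrable_compProd_iff hi.1).1 hi).1, ?_⟩
  have := Integrable.integral_compProd hi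
  simpa only [Kernel.prodMkLeft_apply, Kernel.const_apply,
    integral_condDensityKernel hf.1 hf.2.1 hfA.1 hfA.2.1] using this

/-- Conditional Jensen: `(K h)² ≤ K (h²)`, obtained from nonnegativity of the variance of `h` under
each conditional law. -/
theorem IsDensity.memLp_condOp (hX : Measurable X) (hU : Measurable U)
    (hfA : IsDensity P X μ fA) (hf : IsDensity P (fun ω => (X ω, U ω)) (μ.prod ν) f)
    {h : B → ℝ} (hh : Measurable h) (h2 : MemLp h 2 (P.map U)) :
    MemLp (condOp ν f fA h) 2 (P.map X) := by
  have hm := measurable_condOp (ν := ν) hf.1 hfA.1 hh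
  rw [memLp_two_iff_integrable_sq hm.aestronglyMeasurable]
  obtain ⟨h3, h4⟩ := hfA.ae_integrable_condDensityKernel hX hU hf h2.integrable_sq
  refine h4.mono' (hm.pow_const 2).aestronglyMeasurable ?_
  filter_upwards [h3, hfA.isProbabilityMeasure_condDensityKernel hX hU hf] with a ha hp
  have hL : MemLp h 2 (condDensityKernel ν f fA a) :=
    (memLp_two_iff_integrable_sq hh.aestronglyMeasurable).2 ha
  have hv := variance_nonneg h (condDensityKernel ν f fA a)
  rw [variance_eq_sub hL] at hv
  rw [Real.norm_of_nonneg (sq_nonneg _)]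
  simp only [← integral_condDensityKernel hf.1 hf.2.1 hfA.1 hfA.2.1]
  simpa using hv

end CondKernel

/-! ### Series of L² functions with ℓ¹ coefficients. -/

/-- Cauchy–Schwarz with weights `|a n|`, applied to `|x n|` and the constant `1`. -/
theorem sq_tsum_mul_le {ι : Type*} {a x : ι → ℝ} (ha : Summable fun n => |a n|)
    (hx : Summable fun n => |a n| * x n ^ 2) :
    (∑' n, a n * x n) ^ 2 ≤ (∑' n, |a n|) * ∑' n, |a n| * x n ^ 2 := by
  have h1 : Summable fun n => |a n| * |x n| := by
    refine Summable.of_nonneg_of_le (fun n => by positivity) (fun n => ?_) (ha.add hx)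
    have : |x n| ≤ 1 + x n ^ 2 := by
      rw [← sq_abs]
      nlinarith [sq_nonneg (|x n| - 1), abs_nonneg (x n)]
    nlinarith [abs_nonneg (a n), mul_le_mul_of_nonneg_left this (abs_nonneg (a n))]
  have h2 : Summable fun n => ‖a n * x n‖ := by simpa [abs_mul] using h1
  set A := ∑' n, |a n|
  set B := ∑' n, |a n| * x n ^ 2
  set T := ∑' n, |a n| * |x n|
  have hT : |∑' n, a n * x n| ≤ T := by
    simpa [abs_mul] using norm_tsum_le_tsum_norm h2
  have hA : 0 ≤ A := tsum_nonneg fun n => abs_nonneg _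
  -- Expand `∑ |a n| (A |x n| - T)² ≥ 0`, where `T / A` is the weighted mean of `|x n|`.
  have hquad : 0 ≤ A * (A * B - T ^ 2) := by
    have hs : HasSum (fun n => |a n| * (A * |x n| - T) ^ 2)
        (A ^ 2 * B - 2 * A * T * T + T ^ 2 * A) := by
      refine (((hx.hasSum.mul_left (A ^ 2)).sub (h1.hasSum.mul_left (2 * A * T))).add
        (ha.hasSum.mul_left (T ^ 2))).congr_fun fun n => ?_
      rw [← sq_abs (x n)]
      ring
    have := hs.nonneg fun n => by positivity
    linarith
  have hTAB : T ^ 2 ≤ A * B := by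
    rcases hA.eq_or_lt with h0 | h0
    · have hz : ∀ n, |a n| = 0 := fun n =>
        le_antisymm ((ha.le_tsum n fun _ _ => abs_nonneg _).trans h0.ge) (abs_nonneg _)
      have : T = 0 := by simp [T, hz]
      rw [this, ← h0]
      simp
    · nlinarith [nonneg_of_mul_nonneg_right hquad h0]
  exact (sq_le_sq' (abs_le.1 hT).1 (abs_le.1 hT).2).trans hTAB

theorem memLp_two_tsum_mul {ι B : Type*} [Countable ι] [MeasurableSpace B]
    {ν : Measure B} {φ : ι → B → ℝ} {a : ι → ℝ} (hφ : ∀ n, Measurable (φ n))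
    (hφ2 : ∀ n, MemLp (φ n) 2 ν) (hφ1 : ∀ n, ∫ u, φ n u * φ n u ∂ν = 1)
    (ha : Summable fun n => |a n|) :
    MemLp (fun u => ∑' n, a n * φ n u) 2 ν := by
  have hm : ∀ n, Measurable fun u => ENNReal.ofReal (|a n| * φ n u ^ 2) := fun n => by
    have := hφ n
    fun_prop
  -- Summing in `ENNReal` gives `∫ G = ∑ |a n| < ∞` by Tonelli, so the real series converges almost
  -- everywhere.
  set G : B → ENNReal := fun u => ∑' n, ENNReal.ofReal (|a n| * φ n u ^ 2)
  have hGm : Measurable G := Measurable.tsum hm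
  have hG : ∫⁻ u, G u ∂ν ≠ ⊤ := by
    rw [lintegral_tsum fun n => (hm n).aemeasurable]
    have : ∀ n, ∫⁻ u, ENNReal.ofReal (|a n| * φ n u ^ 2) ∂ν = ENNReal.ofReal |a n| := fun n => by
      rw [← ofReal_integral_eq_lintegral_ofReal ((hφ2 n).integrable_sq.const_mul _)
        (.of_forall fun u => by positivity), integral_const_mul]
      simp_rw [sq, hφ1, mul_one]
    simp_rw [this]
    rw [← ENNReal.ofReal_tsum_of_nonneg (fun _ => abs_nonneg _) ha]
    exact ENNReal.ofReal_ne_top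
  have key : ∀ᵐ u ∂ν, (Summable fun n => |a n| * φ n u ^ 2) ∧
      ∑' n, |a n| * φ n u ^ 2 = (G u).toReal := by
    filter_upwards [ae_lt_top hGm hG] with u hu
    have hs : Summable fun n => (ENNReal.ofReal (|a n| * φ n u ^ 2)).toReal :=
      ENNReal.summable_toReal hu.ne
    have he : ∀ n, (ENNReal.ofReal (|a n| * φ n u ^ 2)).toReal = |a n| * φ n u ^ 2 :=
      fun n => ENNReal.toReal_ofReal (by positivity)
    refine ⟨by simpa only [he] using hs, ?_⟩
    rw [ENNReal.tsum_toReal_eq fun n => ENNReal.ofReal_ne_top]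
    simp only [he]
  have hS : Measurable fun u => ∑' n, a n * φ n u :=
    Measurable.tsum fun n => (hφ n).const_mul _
  rw [memLp_two_iff_integrable_sq hS.aestronglyMeasurable]
  refine ((integrable_toReal_of_lintegral_ne_top hGm.aemeasurable hG).const_mul
    (∑' n, |a n|)).mono' (hS.pow_const 2).aestronglyMeasurable ?_
  filter_upwards [key] with u hu
  rw [Real.norm_of_nonneg (sq_nonneg _), ← hu.2]
  exact sq_tsum_mul_le ha hu.1

/-- Sum and integral commute because `∫ |a n φ n φ k| ≤ |a n|`, by `2|pq| ≤ p² + q²` and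
normalization. -/
theorem integral_tsum_mul_of_orthonormal {ι B : Type*} [Countable ι] [MeasurableSpace B]
    {ν : Measure B} {φ : ι → B → ℝ} {a : ι → ℝ} (hφ2 : ∀ n, MemLp (φ n) 2 ν)
    (hφ1 : ∀ n, ∫ u, φ n u * φ n u ∂ν = 1)
    (hφ0 : ∀ m n, m ≠ n → ∫ u, φ m u * φ n u ∂ν = 0) (ha : Summable fun n => |a n|) (k : ι) :
    ∫ u, (∑' n, a n * φ n u) * φ k u ∂ν = a k := by
  have hi : ∀ m n, Integrable (fun u => φ m u * φ n u) ν := fun m n =>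
    (hφ2 m).integrable_mul (hφ2 n)
  have hF : ∀ n, Integrable (fun u => a n * φ n u * φ k u) ν := fun n => by
    simpa only [mul_assoc] using (hi n k).const_mul (a n)
  have hle : ∀ n, ∫ u, ‖a n * φ n u * φ k u‖ ∂ν ≤ |a n| := fun n => by
    have h1 : ∫ u, |a n| * (φ n u * φ n u + φ k u * φ k u) / 2 ∂ν = |a n| := by
      rw [integral_div, integral_const_mul, integral_add (hi n n) (hi k k), hφ1, hφ1]
      ring
    refine (integral_mono (hF n).norm ?_ fun u => ?_).trans_eq h1
    · exact (((hi n n).add (hi k k)).const_mul _).div_const 2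
    · simp only [Real.norm_eq_abs, abs_mul]
      have := mul_le_mul_of_nonneg_left (two_mul_le_add_sq |φ n u| |φ k u|) (abs_nonneg (a n))
      rw [sq_abs, sq_abs] at this
      linarith
  have hs : Summable fun n => ∫ u, ‖a n * φ n u * φ k u‖ ∂ν :=
    Summable.of_nonneg_of_le (fun n => integral_nonneg fun u => norm_nonneg _) hle ha
  have := hasSum_integral_of_summable_integral_norm hF hs
  simp_rw [tsum_mul_right] at this
  rw [← this.tsum_eq, tsum_eq_single k fun n hn => by
    simp_rw [mul_assoc, integral_const_mul, hφ0 n k hn, mul_zero]]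
  simp_rw [mul_assoc, integral_const_mul, hφ1 k, mul_one]

/-! ### Adjointness, singular values, totality of the `ψ n`. -/

section SingularSystem

variable {Ω 𝒳 𝒰 ι : Type*} [MeasurableSpace Ω] [MeasurableSpace 𝒳] [MeasurableSpace 𝒰]
  {P : Measure Ω} {X : Ω → 𝒳} {U : Ω → 𝒰}
  {μX : Measure 𝒳} {μU : Measure 𝒰} [SigmaFinite μX] [SigmaFinite μU]
  {fX : 𝒳 → ℝ} {fU : 𝒰 → ℝ} {fXU : 𝒳 × 𝒰 → ℝ}

/-- `K*` is the operator `K` of the pair `(U, X)`. -/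
theorem condOpAdj_eq_condOp {𝒳 𝒰 : Type*} [MeasurableSpace 𝒳] (μX : Measure 𝒳) (fXU : 𝒳 × 𝒰 → ℝ) (fU : 𝒰 → ℝ) :
    condOpAdj μX fXU fU = condOp μX (fun z => fXU z.swap) fU :=
  rfl

theorem integrable_comp_mul_comp (hX : Measurable X) (hU : Measurable U) {h : 𝒰 → ℝ} {g : 𝒳 → ℝ}
    (h2 : MemLp h 2 (P.map U)) (g2 : MemLp g 2 (P.map X)) :
    Integrable (fun ω => h (U ω) * g (X ω)) P :=
  (h2.comp_measurePreserving (hU.measurePreserving P)).integrable_mul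
    (g2.comp_measurePreserving (hX.measurePreserving P))

variable [IsProbabilityMeasure P]

/-- `⟨K h, g⟩ = ⟨h, K* g⟩`. -/
theorem IsDensity.integral_condOp_mul_eq (hX : Measurable X) (hU : Measurable U)
    (hfX : IsDensity P X μX fX) (hfU : IsDensity P U μU fU)
    (hfXU : IsDensity P (fun ω => (X ω, U ω)) (μX.prod μU) fXU)
    {h : 𝒰 → ℝ} {g : 𝒳 → ℝ} (hh : Measurable h) (hg : Measurable g)
    (h2 : MemLp h 2 (P.map U)) (g2 : MemLp g 2 (P.map X)) :
    ∫ x, condOp μU fXU fX h x * g x ∂(P.map X)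
      = ∫ u, h u * condOpAdj μX fXU fU g u ∂(P.map U) := by
  have hi := integrable_comp_mul_comp hX hU h2 g2
  rw [hfX.integral_condOp_mul hX hU hfXU hh hg hi, condOpAdj_eq_condOp]
  simp_rw [mul_comm (h _)] at hi ⊢
  exact (hfU.integral_condOp_mul hU hX (hfXU.swap hX hU) hg hh hi).symm

theorem IsDensity.memLp_condOpAdj (hX : Measurable X) (hU : Measurable U)
    (hfU : IsDensity P U μU fU)
    (hfXU : IsDensity P (fun ω => (X ω, U ω)) (μX.prod μU) fXU)
    {g : 𝒳 → ℝ} (hg : Measurable g) (g2 : MemLp g 2 (P.map X)) :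
    MemLp (condOpAdj μX fXU fU g) 2 (P.map U) :=
  hfU.memLp_condOp hU hX (hfXU.swap hX hU) hg g2

/-- `s n = E[φ n (U) ψ n (X)]`, at most half the sum of the two second moments, each equal to `1`.
-/
theorem IsSingularSystem.le_one {s : ι → ℝ} {φ : ι → 𝒰 → ℝ} {ψ : ι → 𝒳 → ℝ}
    (hX : Measurable X) (hU : Measurable U)
    (hfX : IsDensity P X μX fX) (hfU : IsDensity P U μU fU)
    (hfXU : IsDensity P (fun ω => (X ω, U ω)) (μX.prod μU) fXU)
    (hsvd : IsSingularSystem μX μU (P.map X) (P.map U) fXU fX fU s φ ψ) (n : ι) : s n ≤ 1 := by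
  obtain ⟨hφ, hφ2⟩ := (hfU.memL2Density_iff _).1 (hsvd.memL2_left n)
  obtain ⟨hψ, hψ2⟩ := (hfX.memL2Density_iff _).1 (hsvd.memL2_right n)
  have hφ1 := (hfU.innerDensity_eq _ _).symm.trans (hsvd.norm_left n)
  have hψ1 := (hfX.innerDensity_eq _ _).symm.trans (hsvd.norm_right n)
  have hi := integrable_comp_mul_comp hX hU hφ2 hψ2
  have e1 : ∫ ω, φ n (U ω) * ψ n (X ω) ∂P = s n := by
    rw [← hfX.integral_condOp_mul hX hU hfXU hφ hψ hi]
    have : ∫ x, condOp μU fXU fX (φ n) x * ψ n x ∂(P.map X)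
        = ∫ x, s n * (ψ n x * ψ n x) ∂(P.map X) := by
      refine integral_congr_ae ?_
      filter_upwards [hsvd.map_left n] with x hx
      rw [hx, mul_assoc]
    rw [this, integral_const_mul, hψ1, mul_one]
  have e2 : ∫ ω, φ n (U ω) * φ n (U ω) ∂P = 1 := by
    exact (integral_map hU.aemeasurable (hφ.mul hφ).aestronglyMeasurable).symm.trans hφ1
  have e3 : ∫ ω, ψ n (X ω) * ψ n (X ω) ∂P = 1 := by
    exact (integral_map hX.aemeasurable (hψ.mul hψ).aestronglyMeasurable).symm.trans hψ1
  have i2 : Integrable (fun ω => φ n (U ω) * φ n (U ω)) P :=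
    (hφ2.integrable_mul hφ2).comp_measurable hU
  have i3 : Integrable (fun ω => ψ n (X ω) * ψ n (X ω)) P :=
    (hψ2.integrable_mul hψ2).comp_measurable hX
  have h4 := integral_mono (hi.const_mul 2) (i2.add i3) fun ω => by
    have := two_mul_le_add_sq (φ n (U ω)) (ψ n (X ω))
    simp only [Pi.add_apply]
    linarith
  simp only [Pi.add_apply] at h4
  rw [integral_const_mul, integral_add i2 i3, e1, e2, e3] at h4
  linarith

/-- Under completeness, the functions `ψ n` are total in `L²(f(x))`. -/
theorem IsSingularSystem.ae_eq_zero_of_integral_mul_eq_zero {s : ι → ℝ} {φ : ι → 𝒰 → ℝ}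
    {ψ : ι → 𝒳 → ℝ} (hX : Measurable X) (hU : Measurable U)
    (hfX : IsDensity P X μX fX) (hfU : IsDensity P U μU fU)
    (hfXU : IsDensity P (fun ω => (X ω, U ω)) (μX.prod μU) fXU)
    (hsvd : IsSingularSystem μX μU (P.map X) (P.map U) fXU fX fU s φ ψ)
    (hcomplete : CompleteFstGivenSnd μX (P.map X) (P.map U) fXU fX fU)
    {g : 𝒳 → ℝ} (hg : Measurable g) (g2 : MemLp g 2 (P.map X))
    (hgψ : ∀ n, ∫ x, ψ n x * g x ∂(P.map X) = 0) : ∀ᵐ x ∂(P.map X), g x = 0 := by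
  refine (hcomplete g ((hfX.memL2Density_iff g).2 ⟨hg, g2⟩)).1 ?_
  set w := condOpAdj μX fXU fU g with hw
  have hwm : Measurable w :=
    measurable_condOp (ν := μX) (hfXU.swap hX hU).1 hfU.1 hg
  have hw2 : MemLp w 2 (P.map U) := hfU.memLp_condOpAdj hX hU hfXU hg g2
  -- `⟨φ n, K* g⟩ = s n ⟨ψ n, g⟩ = 0`, so `w = K* g` lies in the kernel of `K`.
  have hker := hsvd.kernel w ((hfU.memL2Density_iff w).2 ⟨hwm, hw2⟩) fun n => by
    obtain ⟨hφ, hφ2⟩ := (hfU.memL2Density_iff _).1 (hsvd.memL2_left n)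
    rw [hfU.innerDensity_eq]
    simp_rw [mul_comm (w _)]
    rw [hw, ← hfX.integral_condOp_mul_eq hX hU hfU hfXU hφ hg hφ2 g2]
    have : ∫ x, condOp μU fXU fX (φ n) x * g x ∂(P.map X)
        = ∫ x, s n * (ψ n x * g x) ∂(P.map X) := by
      refine integral_congr_ae ?_
      filter_upwards [hsvd.map_left n] with x hx
      rw [hx, mul_assoc]
    rw [this, integral_const_mul, hgψ, mul_zero]
  -- `‖K* g‖² = ⟨K K* g, g⟩ = 0`.
  have h0 : ∫ u, w u * w u ∂(P.map U) = 0 := by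
    have := hfX.integral_condOp_mul_eq hX hU hfU hfXU hwm hg hw2 g2
    rw [← hw] at this
    rw [← this]
    refine integral_eq_zero_of_ae ?_
    filter_upwards [hker] with x hx
    simp [hx]
  filter_upwards [(integral_eq_zero_iff_of_nonneg (fun u => mul_self_nonneg (w u))
    (hw2.integrable_mul hw2)).1 h0] with u hu
  simpa using hu

end SingularSystem

/-! ### The Picard series solves the integral equation. -/

theorem mainTheorem7
    {Ω 𝒳 𝒰 𝒴 ι : Type*} [MeasurableSpace Ω] [MeasurableSpace 𝒳] [MeasurableSpace 𝒰]
    [MeasurableSpace 𝒴] [Countable ι]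
    -- the probability space, the random variables, and the reference measures `dx`, `du`, `dy`
    (P : Measure Ω) [IsProbabilityMeasure P]
    (X : Ω → 𝒳) (U : Ω → 𝒰) (Y : Ω → 𝒴)
    (hX : Measurable X) (hU : Measurable U) (hY : Measurable Y)
    (μX : Measure 𝒳) (μU : Measure 𝒰) (μY : Measure 𝒴)
    [SigmaFinite μX] [SigmaFinite μU] [SigmaFinite μY]
    -- densities of `X`, `U`, `(X, U)` and `(X, Y)`
    (fX : 𝒳 → ℝ) (fU : 𝒰 → ℝ) (fXU : 𝒳 × 𝒰 → ℝ) (fXY : 𝒳 × 𝒴 → ℝ)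
    (hfX : IsDensity P X μX fX) (hfU : IsDensity P U μU fU)
    (hfXU : IsDensity P (fun ω => (X ω, U ω)) (μX.prod μU) fXU)
    (hfXY : IsDensity P (fun ω => (X ω, Y ω)) (μX.prod μY) fXY)
    -- a singular value decomposition of `K : L²(f(u)) → L²(f(x))`
    (s : ι → ℝ) (φ : ι → 𝒰 → ℝ) (ψ : ι → 𝒳 → ℝ)
    (hsvd : IsSingularSystem μX μU (P.map X) (P.map U) fXU fX fU s φ ψ)
    -- completeness of the law of `X` given `U`
    (hcomplete : CompleteFstGivenSnd μX (P.map X) (P.map U) fXU fX fU)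
    -- `∬ f(u|x) f(x|u) dx du < ∞`
    (hHS : Integrable
      (fun z : 𝒳 × 𝒰 => condSnd fXU fX z.2 z.1 * condFst fXU fU z.1 z.2) (μX.prod μU))
    -- `∫ f(y|x)² f(x) dx < ∞`
    (hsq : ∀ y, Integrable (fun x => condSnd fXY fX y x ^ 2 * fX x) μX)
    -- `∑ₙ λₙ⁻² |⟨f(y|·), ψₙ⟩| < ∞`
    (hpicard : ∀ y,
      Summable (fun n => (s n ^ 2)⁻¹ * |innerDensity μX fX (condSnd fXY fX y) (ψ n)|)) :
    ∃ h : 𝒰 → 𝒴 → ℝ, Measurable (Function.uncurry h) ∧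
      ∀ y, MemL2Density μU fU (fun u => h u y) ∧
        ∀ᵐ x ∂(P.map X), Integrable (fun u => h u y * condSnd fXU fX u x) μU ∧
          ∫ u, h u y * condSnd fXU fX u x ∂μU = condSnd fXY fX y x := by
  have : IsProbabilityMeasure (P.map U) := Measure.isProbabilityMeasure_map hU.aemeasurable
  have hφ n := (hfU.memL2Density_iff _).1 (hsvd.memL2_left n)
  have hψ n := (hfX.memL2Density_iff _).1 (hsvd.memL2_right n)
  have hφ1 n := (hfU.innerDensity_eq _ _).symm.trans (hsvd.norm_left n)
  have hφ0 m n hmn := (hfU.innerDensity_eq _ _).symm.trans (hsvd.orthogonal_left m n hmn)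
  set c : ι → 𝒴 → ℝ := fun n y => innerDensity μX fX (condSnd fXY fX y) (ψ n) with hc
  have hcm : ∀ n, Measurable (c n) := fun n => by
    have h1 : Measurable fun z : 𝒳 × 𝒴 => condSnd fXY fX z.2 z.1 * ψ n z.1 * fX z.1 :=
      ((measurable_condSnd hfXY.1 hfX.1).mul ((hψ n).1.comp measurable_fst)).mul
        (hfX.1.comp measurable_fst)
    exact h1.stronglyMeasurable.integral_prod_left'.measurable
  have hsum : ∀ y, Summable fun n => |(s n)⁻¹ * c n y| := fun y => by
    refine Summable.of_nonneg_of_le (fun n => abs_nonneg _) (fun n => ?_) (hpicard y)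
    have hs0 := hsvd.pos n
    have hs1 := hsvd.le_one hX hU hfX hfU hfXU n
    rw [abs_mul, abs_of_pos (inv_pos.2 hs0)]
    refine mul_le_mul_of_nonneg_right (inv_anti₀ (pow_pos hs0 2) ?_) (abs_nonneg _)
    nlinarith
  -- A pointwise sum, equal to `0` where the series is not summable; for each `y` this is a null set
  -- for the law of `U`.
  set h : 𝒰 → 𝒴 → ℝ := fun u y => ∑' n, (s n)⁻¹ * c n y * φ n u
  have hm : Measurable (Function.uncurry h) := Measurable.tsum fun n =>
    (((hcm n).comp measurable_snd).const_mul _).mul ((hφ n).1.comp measurable_fst)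
  refine ⟨h, hm, fun y => ?_⟩
  have hym : Measurable fun u => h u y := hm.comp measurable_prodMk_right
  have hy2 : MemLp (fun u => h u y) 2 (P.map U) :=
    memLp_two_tsum_mul (fun n => (hφ n).1) (fun n => (hφ n).2) hφ1 (hsum y)
  refine ⟨(hfU.memL2Density_iff _).2 ⟨hym, hy2⟩, ?_⟩
  have hKm := measurable_condOp (ν := μU) hfXU.1 hfX.1 hym
  have hK2 := hfX.memLp_condOp hX hU hfXU hym hy2
  have hqm : Measurable (condSnd fXY fX y) :=
    (measurable_condSnd hfXY.1 hfX.1).comp measurable_prodMk_right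
  have hq2 : MemLp (condSnd fXY fX y) 2 (P.map X) :=
    ((hfX.memL2Density_iff _).1 ⟨hqm, hsq y⟩).2
  have hzero := hsvd.ae_eq_zero_of_integral_mul_eq_zero hX hU hfX hfU hfXU hcomplete
    (hqm.sub hKm) (hq2.sub hK2) fun n => by
      have e1 : ∫ x, ψ n x * condSnd fXY fX y x ∂(P.map X) = c n y := by
        simp_rw [hc, hfX.innerDensity_eq, mul_comm]
      have e2 : ∫ x, ψ n x * condOp μU fXU fX (fun u => h u y) x ∂(P.map X) = c n y := by
        simp_rw [mul_comm (ψ n _)]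
        rw [hfX.integral_condOp_mul_eq hX hU hfU hfXU hym (hψ n).1 hy2 (hψ n).2]
        have e3 : ∫ u, h u y * condOpAdj μX fXU fU (ψ n) u ∂(P.map U)
            = ∫ u, s n * (h u y * φ n u) ∂(P.map U) := by
          refine integral_congr_ae ?_
          filter_upwards [hsvd.map_right n] with u hu
          rw [hu]
          ring
        rw [e3, integral_const_mul, integral_tsum_mul_of_orthonormal (fun n => (hφ n).2) hφ1 hφ0
          (hsum y) n, mul_inv_cancel_left₀ (hsvd.pos n).ne']
      simp only [Pi.sub_apply, mul_sub]
      refine (integral_sub ((hψ n).2.integrable_mul hq2) ((hψ n).2.integrable_mul hK2)).trans ?_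
      simp only [Pi.mul_apply, e1, e2, sub_self]
  -- Absolute convergence: `h (·, y)` is integrable for the law of `U`, hence for almost every
  -- conditional law given `X = x`.
  filter_upwards [hzero, (hfX.ae_integrable_condDensityKernel hX hU hfXU
    (hy2.integrable one_le_two)).1] with x hx hxi
  exact ⟨(integrable_condDensityKernel hfXU.1 hfXU.2.1 hfX.1 hfX.2.1 _ x).1 hxi,
    (sub_eq_zero.1 hx).symm⟩
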